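/- Let $\mathcal G(v,e)$ be the set of simple graphs with $v$ vertices and $e$ edges, and call $G\in\mathcal G(v,e)$ optimal if the sum $P_2(G)$ of the squares of its vertex degrees is maximum over $\mathcal G(v,e)$. Let $\mathrm{Dis}(v,e)$ be the set of partitions $\pi=(a_0,a_1,\dots,a_p)$ of $e$ with $v>a_0>a_1>\cdots>a_p>0$. The threshold graph $\mathrm{Th}(\pi)\in\mathcal G(v,e)$ is the graph on the vertices $0,\dots,v-1$ in which, for $s<t$, the vertices $s,t$ are adjacent if and only if $t\le s+a_s$ (where $a_s=0$ for $s>p$). The partition $\pi\in \mathrm{Dis}(v,e)$ is called optimal if $\mathrm{Th}(\pi)$ is optimal in $\mathcal G(v,e)$. For $0\le e\le\binom v2$ let $k,j,k',j'$ be the unique integers with $$e=\binom{k+1}2-j,\quad 1\le j\le k,\qquad e=\binom v2-\binom{k'+1}2+j',\quad 1\le j'\le k',$$ and consider the following partitions, a hat marking an omitted part: - $\pi_{1.1}=(v-1,v-2,\dots,k'+1,j')$ (read as the empty partition if $k'=v$); - $\pi_{1.2}=(v-1,v-2,\dots,\widehat{2k'-j'-1},\dots,k'-1)$, which exists only if $k'+1\le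 2k'-j'-1\le v-1$; - $\pi_{1.3}=(v-1,v-2,\dots,k'+1,2,1)$, which exists only if $j'=3$ and $v\ge4$; - $\pi_{2.1}=(k,k-1,\dots,\widehat{j},\dots,2,1)$; - $\pi_{2.2}=(2k-j-1,k-2,k-3,\dots,2,1)$, which exists only if $k+1\le 2k-j-1\le v-1$; - $\pi_{2.3}=(k,k-1,\dots,3)$, which exists only if $j=3$ and $v\ge4$. **Theorem.** Let $v>9$ and $k$ be positive integers with $$(2v-1)^2-2(2k+1)^2=-49 .$$ Then $\frac12\binom v2$ is an integer. Put $e=\frac12\binom v2$. The integers attached above to $(v,e)$ are $k$ itself, $k'=k$ and $j=j'=3$, and there are exactly four optimal partitions in $\mathrm{Dis}(v,e)$, namely $$\begin{aligned} \pi_{1.1}&=(v-1,v-2,\dots,k+1,3), & \pi_{1.3}&=(v-1,v-2,\dots,k+1,2,1),\\ \pi_{2.1}&=(k,k-1,\dots,4,2,1), & \pi_{2.3}&=(k,k-1,\dots,4,3). \end{aligned}$$ The partitions $\pi_{1.2}$ and $\pi_{2.2}$ do not exist. Moreover, there are infinitely many integers $v>9$ for which some positive integer $k$ satisfies the equation.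 -/

import Mathlib

/-- `P₂(G)`: the sum of the squares of the degrees of a graph on `v` vertices. -/
noncomputable def P2 {v : ℕ} (G : SimpleGraph (Fin v)) : ℕ :=
  open Classical in ∑ i, G.degree i ^ 2

/-- The class `𝒢(v,e)` of simple graphs with `v` vertices and `e` edges. -/
def graphClass (v e : ℕ) : Set (SimpleGraph (Fin v)) :=
  {G | G.edgeSet.ncard = e}

/-- `G` is optimal in `𝒢(v,e)`: it lies in the class and `P₂` attains there its maximum over the
whole class. -/
def IsOptimalGraph (v e : ℕ) (G : SimpleGraph (Fin v)) : Prop :=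
  G ∈ graphClass v e ∧ ∀ H ∈ graphClass v e, P2 H ≤ P2 G

/-- `Dis(v,e)`: the partitions `(a₀, a₁, …, a_p)` of `e` with `v > a₀ > a₁ > ⋯ > a_p > 0`, written
as strictly decreasing lists. -/
def Dis (v e : ℕ) : Set (List ℕ) :=
  {π | π.Pairwise (· > ·) ∧ (∀ a ∈ π, 0 < a ∧ a < v) ∧ π.sum = e}

/-- The threshold graph `Th(π)` of `π = (a₀, a₁, …)`: with rows and columns numbered `0, …, v-1`,
the upper triangular part of row `s` of the adjacency matrix has its ones left-justified and
exactly `a_s` of them, that is, in the columns `s+1, …, s+a_s` (with `a_s = 0` beyond the end of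
the list). -/
def Th (v : ℕ) (π : List ℕ) : SimpleGraph (Fin v) where
  Adj s t := (s < t ∧ (t : ℕ) ≤ s + π.getD s 0) ∨ (t < s ∧ (s : ℕ) ≤ t + π.getD t 0)
  symm := ⟨fun _ _ h => h.symm⟩
  loopless := ⟨fun s h => by simp at h⟩

/-- `π` is an optimal partition in `Dis(v,e)`. -/
def IsOptimalPartition (v e : ℕ) (π : List ℕ) : Prop :=
  π ∈ Dis v e ∧ IsOptimalGraph v e (Th v π)

/-- `e = C(k+1,2) - j` with `1 ≤ j ≤ k`. -/
def IsQCParams (e k j : ℕ) : Prop :=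
  1 ≤ j ∧ j ≤ k ∧ (e : ℤ) = ((k + 1).choose 2 : ℤ) - j

/-- `e = C(v,2) - C(k'+1,2) + j'` with `1 ≤ j' ≤ k'`. -/
def IsQSParams (v e k' j' : ℕ) : Prop :=
  1 ≤ j' ∧ j' ≤ k' ∧ (e : ℤ) = (v.choose 2 : ℤ) - ((k' + 1).choose 2 : ℤ) + j'

/-- The decreasing list `(a, a-1, …, b)`, empty if `a < b`. -/
def desc (a b : ℕ) : List ℕ := (List.range' b (a + 1 - b)).reverse

/-- `π` is `π₁.₁ = (v-1, v-2, …, k'+1, j')`, the quasi-star partition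
(read as the empty partition if `k' = v`, which occurs only for `e = 0`). -/
def IsPi11 (v e : ℕ) (π : List ℕ) : Prop :=
  ∃ k' j', IsQSParams v e k' j' ∧ π = if k' = v then [] else desc (v - 1) (k' + 1) ++ [j']

/-- `π` is `π₁.₂`: the list `(v-1, …, k'-1)` with the part `2k'-j'-1` omitted; it exists only if
`k'+1 ≤ 2k'-j'-1 ≤ v-1`. -/
def IsPi12 (v e : ℕ) (π : List ℕ) : Prop :=
  ∃ k' j', IsQSParams v e k' j' ∧
    ((k' : ℤ) + 1 ≤ 2 * k' - j' - 1 ∧ (2 * k' - j' - 1 : ℤ) ≤ v - 1) ∧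
    π = (desc (v - 1) (k' - 1)).erase (2 * k' - j' - 1)

/-- `π` is `π₁.₃ = (v-1, …, k'+1, 2, 1)`; it exists only if `j' = 3` and `v ≥ 4`. -/
def IsPi13 (v e : ℕ) (π : List ℕ) : Prop :=
  ∃ k' j', IsQSParams v e k' j' ∧ (j' = 3 ∧ 4 ≤ v) ∧ π = desc (v - 1) (k' + 1) ++ [2, 1]

/-- `π` is `π₂.₁`: the list `(k, …, 2, 1)` with the part `j` omitted, the quasi-complete
partition. -/
def IsPi21 (e : ℕ) (π : List ℕ) : Prop :=
  ∃ k j, IsQCParams e k j ∧ π = (desc k 1).erase j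

/-- `π` is `π₂.₂ = (2k-j-1, k-2, k-3, …, 2, 1)`; it exists only if `k+1 ≤ 2k-j-1 ≤ v-1`. -/
def IsPi22 (v e : ℕ) (π : List ℕ) : Prop :=
  ∃ k j, IsQCParams e k j ∧
    ((k : ℤ) + 1 ≤ 2 * k - j - 1 ∧ (2 * k - j - 1 : ℤ) ≤ v - 1) ∧
    π = (2 * k - j - 1) :: desc (k - 2) 1

/-- `π` is `π₂.₃ = (k, k-1, …, 3)`; it exists only if `j = 3` and `v ≥ 4`. -/
def IsPi23 (v e : ℕ) (π : List ℕ) : Prop :=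
  ∃ k j, IsQCParams e k j ∧ (j = 3 ∧ 4 ≤ v) ∧ π = desc k 3

/-- The Pell equation `(2v-1)² - 2(2k+1)² = -49`. -/
def PellEq (v k : ℕ) : Prop :=
  (2 * (v : ℤ) - 1) ^ 2 - 2 * (2 * (k : ℤ) + 1) ^ 2 = -49

/-!
A threshold graph on `n + 1` vertices with partition `π` is encoded by the set `A ⊆ {1, …, n}` of
parts of `π`. Its sum of squares of degrees is `weight A`, complementing the graph complements `A`
in `{1, …, n}` (`weight_compl`), and `n ∈ A` says that vertex `0` is dominating.

*From graphs to sets of parts.* In a graph maximising the sum of squares, a vertex of maximum degree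
is joined to every vertex that is not isolated, since otherwise moving one edge would increase the
sum. So there is an isolated or a dominating vertex, and deleting it shows by induction that every
graph is bounded by some `weight A` (`exists_weight_ge`).

*The bound.* Let `C(e)` and `S(n,e)` be the values of the quasi-complete and the quasi-star graph.
The inequality `weight A ≤ max (C(e)) (S(n,e))` of Ahlswede and Katona (`weight_le_max`) follows by
induction on `n`. After complementing, there is a dominating vertex, so by induction the value is
at most `S(n,e)` or the value `D(n,e)` of a quasi-complete graph with a dominating vertex added.
With `e = C(k+1,2) - j`, the difference `C(e) - D(n,e)` is an explicit product which is nonnegative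
for `n ≤ 2k - 3` (`qc_eq_domqc_add`, `qc_eq_domqc_add'`), and for larger `n` the quasi-star graph
wins against `D` (`qc_le_qs`); together this is `domqc_le`.

*The optima.* The Pell equation says that `e = C(k+1,2) - 3` is half of `C(v,2)`. Then `A` and its
complement have the same sum and the same weight, so `v - 1 ∉ A` may be assumed. If the largest part
exceeds `k`, the inequalities above are strict (`domqc_lt_qc`, `qs_lt_qc`) and `A` is not optimal.
Otherwise the parts missing from `{1, …, k}` have sum `3`, hence are `{3}` or `{1, 2}`, and both
have weight `12`. Complementing gives the other two optima.
-/

/-! ### The quasi-complete value as a function of the number of edges -/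

/-- The triangular number `1 + 2 + ⋯ + n`, that is, `C(n+1,2)`. -/
def tri (n : ℕ) : ℕ := (n + 1).choose 2

theorem two_mul_tri (n : ℕ) : 2 * tri n = n * (n + 1) := by
  rw [tri, Nat.choose_two_right, Nat.mul_div_cancel' (Nat.even_mul_pred_self (n + 1)).two_dvd]
  simp [mul_comm]

theorem two_mul_tri_cast (n : ℕ) : 2 * (tri n : ℤ) = n * (n + 1) := by
  exact_mod_cast two_mul_tri n

theorem tri_zero : tri 0 = 0 := rfl

theorem tri_succ (n : ℕ) : tri (n + 1) = tri n + (n + 1) := by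
  have h1 := two_mul_tri n
  have h2 := two_mul_tri (n + 1)
  nlinarith

theorem tri_mono {m n : ℕ} (h : m ≤ n) : tri m ≤ tri n :=
  monotone_nat_of_le_succ (fun k => by rw [tri_succ]; omega) h

theorem le_tri (n : ℕ) : n ≤ tri n := by
  cases n with
  | zero => simp
  | succ m => rw [tri_succ]; omega

/-- The least `k` with `e ≤ C(k+1,2)`; the quasi-complete graph with `e` edges lives on `k + 1`
vertices. -/
def row (e : ℕ) : ℕ := Nat.find (⟨e, le_tri e⟩ : ∃ k, e ≤ tri k)

theorem le_tri_row (e : ℕ) : e ≤ tri (row e) := Nat.find_spec (⟨e, le_tri e⟩ : ∃ k, e ≤ tri k)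

theorem row_le {e k : ℕ} (h : e ≤ tri k) : row e ≤ k := Nat.find_min' _ h

theorem exists_eq_tri_sub {e : ℕ} (he : 0 < e) : ∃ j, e + j = tri (row e) ∧ j < row e := by
  have h := le_tri_row e
  refine ⟨tri (row e) - e, by omega, ?_⟩
  cases hr : row e with
  | zero => rw [hr, tri_zero] at h; omega
  | succ m =>
    have : ¬ e ≤ tri m := fun h' => by have := row_le h'; omega
    rw [tri_succ]
    omega

/-- The sum of the squares of the degrees of the complete graph on `k + 1` vertices with a star of
`j` edges removed. -/
def qcPoly (k j : ℤ) : ℤ := k ^ 2 * (k + 1) - 4 * k * j + j ^ 2 + j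

/-- The sum of the squares of the degrees of the quasi-complete graph with `e` edges. Its edges are
thought of as filling rows, row `m` consisting of the `m` edges that join vertex `m` to the vertices
`0, …, m - 1`. -/
def qc (e : ℕ) : ℤ := qcPoly (row e) (tri (row e) - e)

/-- At `j = k` the formula agrees with the one for `k - 1` and `j = 0`, so the case `j = k` may be
included. -/
theorem qc_eq {e k j : ℕ} (h : e + j = tri k) (hj : j ≤ k) : qc e = qcPoly k j := by
  have h1 : row e ≤ k := row_le (by omega)
  have h2 := le_tri_row e
  rcases h1.eq_or_lt with h1 | h1
  · rw [qc, h1, ← h]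
    push_cast
    congr 1
    ring
  · obtain ⟨m, rfl⟩ : ∃ m, k = m + 1 := ⟨k - 1, by omega⟩
    have h3 := tri_mono (show row e ≤ m by omega)
    rw [tri_succ] at h
    obtain rfl : j = m + 1 := by omega
    obtain rfl : e = tri m := by omega
    have h4 : row (tri m) = m := by
      by_contra hne
      have h5 : row (tri m) + 1 ≤ m := by omega
      have h6 := tri_mono h5
      rw [tri_succ] at h6
      omega
    rw [qc, h4]
    simp only [qcPoly]
    push_cast
    ring

theorem qc_zero : qc 0 = 0 := by
  rw [qc_eq (e := 0) (k := 0) (j := 0) tri_zero.symm le_rfl]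
  simp [qcPoly]

theorem qc_succ_le {i m : ℕ} (h : i + 1 ≤ tri m) : qc (i + 1) ≤ qc i + (4 * m - 2) := by
  obtain ⟨j, h1, h2⟩ := exists_eq_tri_sub (Nat.succ_pos i)
  have h3 : ((row (i + 1) : ℕ) : ℤ) ≤ m := by exact_mod_cast row_le h
  rw [Nat.succ_eq_add_one] at h1 h2
  rw [qc_eq h1 h2.le, qc_eq (k := row (i + 1)) (j := j + 1) (by omega) h2]
  simp only [qcPoly]
  push_cast
  nlinarith

/-! ### Adding a dominating vertex to a quasi-complete graph -/

/-- The sum of the squares of the degrees of the quasi-star graph with `n + 1` vertices and `e`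
edges, computed from its complement; meaningful for `e ≤ C(n+1,2)` only, where the subtraction does
not truncate. -/
def qs (n e : ℕ) : ℤ := qc (tri n - e) + 4 * n * e - (n + 1) * n ^ 2

/-- The sum of the squares of the degrees of the graph with `e` edges that arises from the
quasi-complete graph with `e - n` edges (padded to `n` vertices) by adding a dominating vertex;
meaningful for `n ≤ e`. -/
def domqc (n e : ℕ) : ℤ := qc (e - n) + 4 * (e - n : ℤ) + n * (n + 1)

theorem qs_succ {n e : ℕ} (h : n + 1 ≤ e) :
    qs (n + 1) e = qs n (e - (n + 1)) + 4 * (e - (n + 1) : ℤ) + (n + 1) * (n + 2) := by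
  have h1 : tri (n + 1) - e = tri n - (e - (n + 1)) := by rw [tri_succ]; omega
  rw [qs, qs, h1, Nat.cast_sub h]
  push_cast
  ring

/-- Quasi-star and quasi-complete graphs are complements of each other. -/
theorem qs_compl {n e : ℕ} (h : e ≤ tri n) :
    qs n (tri n - e) + 4 * n * e - (n + 1) * n ^ 2 = qc e := by
  rw [qs, Nat.sub_sub_self h, Nat.cast_sub h]
  linear_combination (2 * n : ℤ) * two_mul_tri_cast n

theorem qs_of_le {n e : ℕ} (h : e ≤ n) : qs n e = e ^ 2 + e := by
  have := le_tri n
  rw [qs, qc_eq (k := n) (j := e) (by omega) h, qcPoly]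
  ring

/-- The quasi-complete value exceeds `domqc n e` by `2 (s - j) (k - 1 - s)` as long as the
`n` edges removed from row `k` of the quasi-complete graph reach row `k - 1` at most. -/
theorem qc_eq_domqc_add {k e j n s : ℕ} (hk : 1 ≤ k) (h : e + j = tri k) (hj : j ≤ k)
    (hn : n + j = k + s) (hs : s + 1 ≤ k) :
    qc e = domqc n e + 2 * (s - j) * (k - 1 - s) := by
  obtain ⟨m, rfl⟩ : ∃ m, k = m + 1 := ⟨k - 1, by omega⟩
  rw [tri_succ] at h
  have h0 := le_tri m
  have h1 : e - n + s = tri m := by omega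
  have h2 : (e : ℤ) + j = tri m + (m + 1) := by exact_mod_cast h
  have h3 : (n : ℤ) = m + 1 + s - j := by have : (n : ℤ) + j = m + 1 + s := by exact_mod_cast hn
                                          linarith
  have h4 : (e : ℤ) = tri m + (m + 1) - j := by linarith
  rw [qc_eq (k := m + 1) (j := j) (by rw [tri_succ]; omega) hj, domqc,
    qc_eq h1 (by omega), h4, h3]
  simp only [qcPoly]
  push_cast
  linear_combination -2 * two_mul_tri_cast m

/-- The same comparison when the removed edges reach row `k - 2`. -/
theorem qc_eq_domqc_add' {k e j n s : ℕ} (hk : 2 ≤ k) (h : e + j = tri k) (hj : j ≤ k)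
    (hn : n + j + 1 = 2 * k + s) (hs : s + 2 ≤ k) :
    qc e = domqc n e + 2 * s * (j - 2 - s) := by
  obtain ⟨m, rfl⟩ : ∃ m, k = m + 2 := ⟨k - 2, by omega⟩
  rw [tri_succ, tri_succ] at h
  have h0 := le_tri m
  have h1 : e - n + s = tri m := by omega
  have h2 : (e : ℤ) + j = tri m + (m + 1) + (m + 2) := by exact_mod_cast h
  have h3 : (n : ℤ) = 2 * m + 3 + s - j := by
    have : (n : ℤ) + j + 1 = 2 * (m + 2) + s := by exact_mod_cast hn
    linarith
  have h4 : (e : ℤ) = tri m + (m + 1) + (m + 2) - j := by linarith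
  rw [qc_eq (k := m + 2) (j := j) (by rw [tri_succ, tri_succ]; omega) hj, domqc,
    qc_eq h1 (by omega), h4, h3]
  simp only [qcPoly]
  push_cast
  linear_combination -2 * two_mul_tri_cast m

/-- Beyond row `m`, a larger dominating star is better. -/
theorem domqc_lt_domqc {e p q m : ℕ} (hpq : p < q) (hq : q ≤ e) (hm : e - p ≤ tri m)
    (hp : 2 * m + 1 ≤ p) : domqc p e < domqc q e := by
  induction q, hpq using Nat.le_induction with
  | base =>
    have h1 : e - (p + 1) + 1 = e - p := by omega
    have h2 := qc_succ_le (i := e - (p + 1)) (m := m) (by omega)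
    rw [h1] at h2
    simp only [domqc]
    push_cast
    have h3 : 2 * (m : ℤ) + 1 ≤ p := by exact_mod_cast hp
    linarith
  | succ q hpq ih =>
    have h1 : e - (q + 1) + 1 = e - q := by omega
    have h2 := qc_succ_le (i := e - (q + 1)) (m := m) (by omega)
    rw [h1] at h2
    refine (ih (by omega)).trans ?_
    simp only [domqc]
    push_cast
    have h3 : 2 * (m : ℤ) + 1 ≤ q := by exact_mod_cast (by omega : 2 * m + 1 ≤ q)
    linarith

/-- A quasi-complete graph on `k + 1` vertices is beaten when at least `2k` of its edges are used
for a dominating vertex instead. -/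
theorem qc_lt_domqc {e k n : ℕ} (hpos : 0 < e) (he : e ≤ tri k) (hn : 2 * k ≤ n)
    (hne : n ≤ e) : qc e < domqc n e := by
  obtain ⟨j, h1, h2⟩ := exists_eq_tri_sub hpos
  have h3 := row_le he
  generalize row e = r at h1 h2 h3
  have hr : 3 ≤ r := by
    by_contra hr
    have : r = 1 ∨ r = 2 := by omega
    rcases this with rfl | rfl
    · have : tri 1 = 1 := rfl
      omega
    · have : tri 2 = 3 := rfl
      omega
  -- Removing `n₀ = 2r - 1 - j + s` edges, with `s = max (j - 2) 0`, costs nothing.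
  obtain ⟨n₀, hn₀⟩ : ∃ n₀, n₀ + j + 1 = 2 * r + (j - 2) := ⟨2 * r + (j - 2) - j - 1, by omega⟩
  have h4 := qc_eq_domqc_add' (by omega) h1 h2.le hn₀ (by omega)
  have h5 : (((j - 2 : ℕ) : ℤ)) * (j - 2 - ((j - 2 : ℕ) : ℤ)) = 0 := by
    rcases le_total 2 j with h | h
    · rw [Nat.cast_sub h]; push_cast; ring
    · rw [Nat.sub_eq_zero_of_le h]; simp
  have h6 : qc e = domqc n₀ e := by rw [h4, mul_assoc, h5]; ring
  rw [h6]
  obtain ⟨m, rfl⟩ : ∃ m, r = m + 2 := ⟨r - 2, by omega⟩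
  rw [tri_succ, tri_succ] at h1
  exact domqc_lt_domqc (m := m) (by omega) hne (by omega) (by omega)

/-- The quasi-complete graph does not beat the star `K_{1,e}`. -/
theorem qc_le_sq_add (e : ℕ) : qc e ≤ e ^ 2 + e ∧ (4 ≤ e → qc e < e ^ 2 + e) := by
  rcases Nat.eq_zero_or_pos e with rfl | hpos
  · simp [qc_zero]
  obtain ⟨j, h1, h2⟩ := exists_eq_tri_sub hpos
  rw [qc_eq h1 h2.le]
  obtain ⟨m, hm⟩ : ∃ m, row e = m + 1 := ⟨row e - 1, by omega⟩
  rw [hm] at h1 h2 ⊢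
  obtain ⟨r, hr⟩ : ∃ r, j + r + 1 = m + 1 := ⟨m - j, by omega⟩
  rw [tri_succ] at h1
  have he : (e : ℤ) = tri m + (r + 1) := by exact_mod_cast (by omega : e = tri m + (r + 1))
  have hj : (j : ℤ) = m - r := by
    have : (j : ℤ) + r + 1 = m + 1 := by exact_mod_cast hr
    linarith
  have key : 4 * ((e : ℤ) ^ 2 + e - qcPoly (m + 1 : ℕ) j) =
      m * (m - 1) * ((m + 1) * (m - 2) + 4 * (r + 1)) := by
    rw [he, hj, qcPoly]
    push_cast
    linear_combination (2 * (tri m : ℤ) + m * (m + 1) + 2 + 4 * (r + 1)) * two_mul_tri_cast m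
  have hr0 : (0 : ℤ) ≤ r := by positivity
  rcases Nat.lt_or_ge m 2 with hm2 | hm2
  · have hz : (m : ℤ) * (m - 1) = 0 := by
      interval_cases m <;> simp
    rw [hz, zero_mul] at key
    refine ⟨by linarith, fun h4 => ?_⟩
    have := tri_mono (show m ≤ 1 by omega)
    have : tri 1 = 1 := rfl
    omega
  · have hm' : (2 : ℤ) ≤ m := by exact_mod_cast hm2
    have : (0 : ℤ) < m * (m - 1) * ((m + 1) * (m - 2) + 4 * (r + 1)) := by
      have h7 : (0 : ℤ) ≤ (m + 1) * (m - 2) := mul_nonneg (by linarith) (by linarith)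
      exact mul_pos (mul_pos (by linarith) (by linarith)) (by linarith)
    exact ⟨by linarith, fun _ => by linarith⟩

/-- A sparse quasi-complete graph does not beat the quasi-star graph. With `e = 3` there is a tie
between the triangle and the star, so strictness needs `4 ≤ e`. -/
theorem qc_le_qs {n : ℕ} : ∀ {e k : ℕ}, e ≤ tri k → 2 * k ≤ n →
    qc e ≤ qs n e ∧ (4 ≤ e → qc e < qs n e) := by
  induction n with
  | zero =>
    intro e k he hk
    obtain rfl : k = 0 := by omega
    obtain rfl : e = 0 := by simpa [tri_zero] using he
    rw [qs_of_le le_rfl]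
    exact qc_le_sq_add 0
  | succ n ih =>
    intro e k he hk
    rcases Nat.lt_or_ge e (n + 1) with hlt | hge
    · rw [qs_of_le hlt.le]
      exact qc_le_sq_add e
    · have h1 := qc_lt_domqc (by omega) he hk hge
      have hle : e - (n + 1) ≤ tri (k - 1) := by
        cases k with
        | zero => rw [tri_zero] at he; omega
        | succ m => rw [tri_succ] at he; simp; omega
      have hk1 : 2 * (k - 1) ≤ n := by omega
      have h2 := (ih hle hk1).1
      have h3 : qc e < qs (n + 1) e := by
        rw [qs_succ hge]
        rw [domqc] at h1
        push_cast at h1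
        linarith
      exact ⟨h3.le, fun _ => h3⟩

/-- Adding a dominating vertex to a quasi-complete graph beats at most one of the quasi-complete
and the quasi-star graph. -/
theorem domqc_le {n e : ℕ} (hn : 0 < n) (hne : n ≤ e) (he : e ≤ tri n) :
    domqc n e ≤ qc e ∨ domqc n e ≤ qs n e ∧ (n + 4 ≤ e → domqc n e < qs n e) := by
  obtain ⟨j, h1, h2⟩ := exists_eq_tri_sub (show 0 < e by omega)
  have h3 := row_le he
  generalize row e = k at h1 h2 h3
  rcases Nat.lt_or_ge (n + j) (2 * k) with hA | hA
  · left
    obtain ⟨s, hs⟩ : ∃ s, n + j = k + s := ⟨n + j - k, by omega⟩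
    have h4 := qc_eq_domqc_add (by omega) h1 h2.le hs (by omega)
    have h5 : (0 : ℤ) ≤ (s - j) * (k - 1 - s) := by
      have a : (j : ℤ) ≤ s := by exact_mod_cast (by omega : j ≤ s)
      have b : (s : ℤ) + 1 ≤ k := by exact_mod_cast (by omega : s + 1 ≤ k)
      exact mul_nonneg (by linarith) (by linarith)
    linarith
  rcases Nat.lt_or_ge (n + 2) (2 * k) with hB | hB
  · left
    obtain ⟨s, hs⟩ : ∃ s, n + j + 1 = 2 * k + s := ⟨n + j + 1 - 2 * k, by omega⟩
    have h4 := qc_eq_domqc_add' (by omega) h1 h2.le hs (by omega)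
    have h5 : (0 : ℤ) ≤ s * (j - 2 - s) := by
      have a : (s : ℤ) + 2 ≤ j := by exact_mod_cast (by omega : s + 2 ≤ j)
      exact mul_nonneg (by positivity) (by linarith)
    linarith
  · right
    obtain ⟨m, rfl⟩ : ∃ m, n = m + 1 := ⟨n - 1, by omega⟩
    have hle : e - (m + 1) ≤ tri (k - 2) := by
      match k, h1, h2, hB with
      | 0, _, h2, _ => omega
      | 1, h1, _, _ => have : tri 1 = 1 := rfl
                       omega
      | k + 2, h1, _, hB => rw [tri_succ, tri_succ] at h1; simp; omega
    have h5 := qc_le_qs (n := m) hle (by omega)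
    rw [qs_succ hne, domqc]
    push_cast
    exact ⟨by linarith [h5.1], fun h => by linarith [h5.2 (by omega)]⟩

/-! ### Threshold graphs as sets of parts -/

/-- The sum of the squares of the degrees of the threshold graph whose partition has the set of
parts `A`: a part `a` stands for a vertex joined to all of the `a` vertices that come after it,
among them those that stand for the smaller parts. -/
def weight (A : Finset ℕ) : ℤ := ∑ a ∈ A, ((a : ℤ) ^ 2 + a + 4 * ∑ b ∈ A with b < a, (b : ℤ))

theorem weight_insert {A : Finset ℕ} {n : ℕ} (h : ∀ b ∈ A, b < n) :
    weight (insert n A) = weight A + 4 * ((∑ b ∈ A, b : ℕ) : ℤ) + n * (n + 1) := by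
  have hn : n ∉ A := fun hn => lt_irrefl _ (h n hn)
  have h1 : (insert n A).filter (· < n) = A := by
    ext b
    simp only [Finset.mem_filter, Finset.mem_insert]
    constructor
    · rintro ⟨rfl | hb, hlt⟩
      · omega
      · exact hb
    · exact fun hb => ⟨Or.inr hb, h b hb⟩
  have h2 : ∀ a ∈ A, (insert n A).filter (· < a) = A.filter (· < a) := by
    intro a ha
    rw [Finset.filter_insert, if_neg (h a ha).not_gt]
  have h3 : ∑ a ∈ A, ((a : ℤ) ^ 2 + a + 4 * ∑ b ∈ insert n A with b < a, (b : ℤ)) = weight A :=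
    Finset.sum_congr rfl fun a ha => by rw [h2 a ha]
  rw [weight, Finset.sum_insert hn, h1, h3]
  push_cast
  ring

theorem weight_empty : weight ∅ = 0 := rfl

theorem sum_Icc_one (n : ℕ) : ∑ a ∈ Finset.Icc 1 n, a = tri n := by
  induction n with
  | zero => rfl
  | succ n ih => rw [Finset.sum_Icc_succ_top (by omega), ih, tri_succ]

theorem sum_sdiff_Icc {A : Finset ℕ} {n : ℕ} (hA : A ⊆ Finset.Icc 1 n) :
    ∑ a ∈ Finset.Icc 1 n \ A, a + ∑ a ∈ A, a = tri n := by
  rw [Finset.sum_sdiff hA, sum_Icc_one]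

theorem subset_Icc_succ {A : Finset ℕ} {n : ℕ} (hA : A ⊆ Finset.Icc 1 (n + 1)) :
    (n + 1 ∉ A ∧ A ⊆ Finset.Icc 1 n) ∨ ∃ B ⊆ Finset.Icc 1 n, A = insert (n + 1) B := by
  by_cases h : n + 1 ∈ A
  · refine Or.inr ⟨A.erase (n + 1), fun a ha => ?_, (Finset.insert_erase h).symm⟩
    have h1 := Finset.mem_Icc.1 (hA (Finset.mem_of_mem_erase ha))
    have h2 := Finset.ne_of_mem_erase ha
    exact Finset.mem_Icc.2 ⟨h1.1, by omega⟩
  · refine Or.inl ⟨h, fun a ha => ?_⟩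
    have h1 := Finset.mem_Icc.1 (hA ha)
    have h2 : a ≠ n + 1 := fun h3 => h (h3 ▸ ha)
    exact Finset.mem_Icc.2 ⟨h1.1, by omega⟩

theorem lt_succ_of_subset_Icc {A : Finset ℕ} {n : ℕ} (hA : A ⊆ Finset.Icc 1 n) :
    ∀ b ∈ A, b < n + 1 := fun b hb => by
  have := Finset.mem_Icc.1 (hA hb)
  omega

theorem sum_insert_succ {A : Finset ℕ} {n : ℕ} (hA : A ⊆ Finset.Icc 1 n) :
    ∑ a ∈ insert (n + 1) A, a = ∑ a ∈ A, a + (n + 1) := by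
  rw [Finset.sum_insert fun h => lt_irrefl _ (lt_succ_of_subset_Icc hA _ h), add_comm]

/-- Complementing the set of parts complements the threshold graph. -/
theorem weight_compl {n : ℕ} : ∀ {A : Finset ℕ}, A ⊆ Finset.Icc 1 n →
    weight A = weight (Finset.Icc 1 n \ A) + 4 * n * ((∑ a ∈ A, a : ℕ) : ℤ)
      - (n + 1) * n ^ 2 := by
  induction n with
  | zero =>
    intro A hA
    obtain rfl : A = ∅ := by simpa using hA
    simp [weight_empty]
  | succ n ih =>
    intro A hA
    have hIcc : Finset.Icc 1 (n + 1) = insert (n + 1) (Finset.Icc 1 n) := by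
      ext a; simp only [Finset.mem_Icc, Finset.mem_insert]; omega
    rcases subset_Icc_succ hA with ⟨hn, hA'⟩ | ⟨B, hB, rfl⟩
    · have h1 : Finset.Icc 1 (n + 1) \ A = insert (n + 1) (Finset.Icc 1 n \ A) := by
        rw [hIcc, Finset.insert_sdiff_of_notMem _ hn]
      have h2 : ((∑ a ∈ Finset.Icc 1 n \ A, a : ℕ) : ℤ) + (∑ a ∈ A, a : ℕ) = tri n := by
        exact_mod_cast sum_sdiff_Icc hA'
      rw [h1, weight_insert (lt_succ_of_subset_Icc Finset.sdiff_subset), ih hA']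
      push_cast at h2 ⊢
      linear_combination (-4) * h2 - 2 * two_mul_tri_cast n
    · have h1 : Finset.Icc 1 (n + 1) \ insert (n + 1) B = Finset.Icc 1 n \ B := by
        ext a
        simp only [Finset.mem_sdiff, Finset.mem_Icc, Finset.mem_insert]
        grind
      rw [h1, weight_insert (lt_succ_of_subset_Icc hB), sum_insert_succ hB, ih hB]
      push_cast
      ring

theorem compl_weight {n : ℕ} {A : Finset ℕ} (hA : A ⊆ Finset.Icc 1 n) :
    weight (Finset.Icc 1 n \ A) = weight A - 4 * n * ((∑ a ∈ A, a : ℕ) : ℤ)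
      + (n + 1) * n ^ 2 := by
  rw [weight_compl hA]; ring

/-! ### The maximum of the weight -/

/-- The theorem of Ahlswede and Katona for threshold graphs: no threshold graph has a larger sum
of squares of degrees than both the quasi-complete and the quasi-star graph. -/
theorem weight_le_max {n : ℕ} : ∀ {A : Finset ℕ}, A ⊆ Finset.Icc 1 n →
    weight A ≤ max (qc (∑ a ∈ A, a)) (qs n (∑ a ∈ A, a)) := by
  induction n with
  | zero =>
    intro A hA
    obtain rfl : A = ∅ := by simpa using hA
    simp [weight_empty, qc_zero]
  | succ n ih =>
    have key : ∀ {B : Finset ℕ}, B ⊆ Finset.Icc 1 n → weight (insert (n + 1) B) ≤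
        max (qc (∑ a ∈ insert (n + 1) B, a)) (qs (n + 1) (∑ a ∈ insert (n + 1) B, a)) := by
      intro B hB
      have h1 := ih hB
      have h2 := sum_insert_succ hB
      have h3 := sum_sdiff_Icc hB
      rw [weight_insert (lt_succ_of_subset_Icc hB)]
      generalize ∑ a ∈ insert (n + 1) B, a = e at h2 ⊢
      have hsub : e - (n + 1) = ∑ a ∈ B, a := by omega
      have hdom := domqc_le (n := n + 1) (e := e) (by omega) (by omega) (by rw [tri_succ]; omega)
      have hqs := qs_succ (n := n) (e := e) (by omega)
      have he : (e : ℤ) = ((∑ a ∈ B, a : ℕ) : ℤ) + (n + 1) := by exact_mod_cast h2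
      simp only [domqc, hsub] at hdom
      rw [hsub] at hqs
      push_cast at hdom hqs ⊢
      push_cast at he
      rcases le_max_iff.1 h1 with h1 | h1
      · rcases hdom with h | h
        · exact le_max_of_le_left (by linarith)
        · exact le_max_of_le_right (by linarith [h.1])
      · exact le_max_of_le_right (by linarith)
    intro A hA
    rcases subset_Icc_succ hA with ⟨hn, hA'⟩ | ⟨B, hB, rfl⟩
    · have h1 : Finset.Icc 1 (n + 1) \ A = insert (n + 1) (Finset.Icc 1 n \ A) := by
        ext a
        simp only [Finset.mem_sdiff, Finset.mem_Icc, Finset.mem_insert]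
        grind
      have h2 := key (B := Finset.Icc 1 n \ A) Finset.sdiff_subset
      rw [← h1] at h2
      have h3 := sum_sdiff_Icc hA
      have h4 : ∑ a ∈ Finset.Icc 1 (n + 1) \ A, a = tri (n + 1) - ∑ a ∈ A, a := by omega
      rw [h4] at h2
      rw [weight_compl hA]
      have h5 := qs_compl (n := n + 1) (e := ∑ a ∈ A, a) (by omega)
      rcases le_max_iff.1 h2 with h | h
      · exact le_max_of_le_right (by rw [qs]; linarith)
      · exact le_max_of_le_left (by linarith)
    · exact key hB

/-! ### The extremal sets of parts -/

theorem compl_add_lt_tri {k e b : ℕ} (he : e + 3 = tri k) (hb : k + 2 ≤ b) :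
    e + b + 4 ≤ tri b := by
  have h1 := tri_mono (show k + 1 ≤ b - 1 by omega)
  obtain ⟨c, rfl⟩ : ∃ c, b = c + 1 := ⟨b - 1, by omega⟩
  rw [tri_succ] at *
  simp only [Nat.add_sub_cancel] at h1
  omega

/-- The quasi-star graph on `b + 1` vertices, padded by an isolated vertex, has as its complement
the graph that arises from a quasi-complete graph by adding a dominating vertex. -/
theorem domqc_compl {b e : ℕ} (h : e + (b + 1) ≤ tri (b + 1)) :
    domqc (b + 1) (tri (b + 1) - e) =
      qs b e - 4 * (b + 1) * e + (b + 2) * (b + 1) ^ 2 := by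
  have h2 : tri (b + 1) - e - (b + 1) = tri b - e := by rw [tri_succ]; omega
  rw [domqc, h2, qs, Nat.cast_sub (by omega), tri_succ]
  push_cast
  linear_combination 2 * two_mul_tri_cast b

/-- Complementary form of `domqc_le`: dropping a vertex from the quasi-star graph does not increase
the value unless the quasi-complete graph is better anyway. -/
theorem qs_le_or_lt {k e b : ℕ} (he : e + 3 = tri k) (hb : k + 1 ≤ b) :
    qs b e ≤ qs (b + 1) e ∨ qs b e < qc e := by
  have h1 := compl_add_lt_tri he (show k + 2 ≤ b + 1 by omega)
  have h2 := domqc_compl (b := b) (e := e) (by omega)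
  have h3 := qs_compl (n := b + 1) (e := e) (by omega)
  have h4 : qs (b + 1) e = qc (tri (b + 1) - e) + 4 * (b + 1) * e - (b + 2) * (b + 1) ^ 2 := by
    rw [qs]; push_cast; ring
  push_cast at h3
  rcases domqc_le (n := b + 1) (e := tri (b + 1) - e) (by omega) (by omega) (by omega) with h | h
  · left; linarith
  · right; linarith [h.2 (by omega)]

/-- Adding a dominating vertex on more than `k` others to a quasi-complete graph loses against the
quasi-complete graph with `C(k+1,2) - 3` edges. -/
theorem domqc_lt_qc {k e n : ℕ} (he : e + 3 = tri k) (hkn : k + 1 ≤ n) (hn : n + 5 ≤ 2 * k) :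
    domqc n e < qc e := by
  obtain ⟨s, hs⟩ : ∃ s, n + 3 = k + s := ⟨n + 3 - k, by omega⟩
  have h := qc_eq_domqc_add (by omega) he (by omega) hs (by omega)
  have a : (4 : ℤ) ≤ s := by exact_mod_cast (by omega : 4 ≤ s)
  have b : (s : ℤ) + 2 ≤ k := by exact_mod_cast (by omega : s + 2 ≤ k)
  have : (0 : ℤ) < (s - 3) * (k - 1 - s) := mul_pos (by linarith) (by linarith)
  push_cast at h
  linarith

/-- When `e` is half the number of pairs, the quasi-star and the quasi-complete graph tie on
`n + 1` vertices, and quasi-star graphs on fewer vertices are worse. -/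
theorem qs_lt_qc {n k e : ℕ} (he : e + 3 = tri k) (hhalf : 2 * e = tri n) (hn : n + 5 ≤ 2 * k)
    {a : ℕ} (hka : k + 1 ≤ a) (han : a < n) : qs a e < qc e := by
  obtain ⟨d, rfl⟩ : ∃ d, n = a + 1 + d := ⟨n - (a + 1), by omega⟩
  induction d generalizing a with
  | zero =>
    have h1 := compl_add_lt_tri he (show k + 2 ≤ a + 1 by omega)
    have h2 := domqc_compl (b := a) (e := e) (by omega)
    have h3 : tri (a + 1) - e = e := by rw [Nat.add_zero] at hhalf; omega
    rw [h3] at h2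
    have h4 : 2 * (e : ℤ) = tri (a + 1) := by exact_mod_cast hhalf
    have h5 := two_mul_tri_cast (a + 1)
    push_cast at h5
    have h6 := domqc_lt_qc he (show k + 1 ≤ a + 1 by omega) hn
    have h7 : domqc (a + 1) e = qs a e := by
      rw [h2]
      linear_combination -(2 * (a + 1) : ℤ) * h4 - (a + 1 : ℤ) * h5
    rwa [h7] at h6
  | succ d ih =>
    have h0 : a + 1 + (d + 1) = (a + 1) + 1 + d := by ring
    rw [h0] at hhalf hn
    have h1 := ih (a := a + 1) (by omega) hhalf hn (by omega)
    rcases qs_le_or_lt he hka with h | h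
    · exact h.trans_lt h1
    · exact h

theorem eq_of_sum_eq_three {B : Finset ℕ} (hpos : ∀ b ∈ B, 1 ≤ b) (hB : ∑ b ∈ B, b = 3) :
    B = {3} ∨ B = {1, 2} := by
  have h1 : B ⊆ Finset.Icc 1 3 := fun b hb =>
    Finset.mem_Icc.2 ⟨hpos b hb, hB ▸ Finset.single_le_sum (fun i _ => Nat.zero_le i) hb⟩
  have h2 : ∀ B ∈ (Finset.Icc 1 3).powerset, ∑ b ∈ B, b = 3 → B = {3} ∨ B = {1, 2} := by decide
  exact h2 B (Finset.mem_powerset.2 h1) hB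

theorem weight_three : weight {3} = 12 := by
  decide

theorem weight_one_two : weight {1, 2} = 12 := by
  decide

/-- The two sets of parts in `{1, …, k}` with sum `C(k+1,2) - 3`. -/
theorem weight_eq_qc_of_sdiff {k e : ℕ} (hk : 3 ≤ k) (he : e + 3 = tri k) {A : Finset ℕ}
    (hA : A = Finset.Icc 1 k \ {3} ∨ A = Finset.Icc 1 k \ {1, 2}) :
    A ⊆ Finset.Icc 1 k ∧ ∑ a ∈ A, a = e ∧ weight A = qc e := by
  have key : ∀ B : Finset ℕ, B ⊆ Finset.Icc 1 k → ∑ b ∈ B, b = 3 → weight B = 12 →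
      ∑ a ∈ Finset.Icc 1 k \ B, a = e ∧ weight (Finset.Icc 1 k \ B) = qc e := by
    intro B hB h3 h12
    have h1 := sum_sdiff_Icc hB
    refine ⟨by omega, ?_⟩
    rw [compl_weight hB, h12, h3, qc_eq he hk, qcPoly]
    push_cast
    ring
  rcases hA with rfl | rfl
  · exact ⟨Finset.sdiff_subset, key {3} (by intro a; simp; omega) rfl weight_three⟩
  · exact ⟨Finset.sdiff_subset, key {1, 2} (by intro a; simp; omega) rfl weight_one_two⟩

/-- Without a dominating vertex, the optimum is the quasi-complete value, and only the two sets of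
parts in `{1, …, k}` attain it. -/
theorem weight_of_subset {n k e : ℕ} (he : e + 3 = tri k) (hk : 4 ≤ k) (hhalf : 2 * e = tri n)
    (hn : n + 5 ≤ 2 * k) {m : ℕ} (hm : m < n) {A : Finset ℕ} (hA : A ⊆ Finset.Icc 1 m)
    (hsum : ∑ a ∈ A, a = e) :
    weight A < qc e ∨ A = Finset.Icc 1 k \ {3} ∨ A = Finset.Icc 1 k \ {1, 2} := by
  induction m with
  | zero =>
    obtain rfl : A = ∅ := by simpa using hA
    have := le_tri k
    simp at hsum
    omega
  | succ m ih =>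
    rcases subset_Icc_succ hA with ⟨-, hA'⟩ | ⟨B, hB, rfl⟩
    · exact ih (by omega) hA'
    rcases lt_trichotomy (m + 1) k with hlt | rfl | hgt
    · have h1 := sum_sdiff_Icc hA
      have h2 := tri_mono (show m + 1 ≤ k - 1 by omega)
      obtain ⟨l, rfl⟩ : ∃ l, k = l + 1 := ⟨k - 1, by omega⟩
      rw [tri_succ l] at he
      simp only [Nat.add_sub_cancel] at h2
      omega
    · right
      have h1 := sum_sdiff_Icc hA
      have h2 : insert (m + 1) B = Finset.Icc 1 (m + 1) \ (Finset.Icc 1 (m + 1) \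
          insert (m + 1) B) := by
        rw [Finset.sdiff_sdiff_eq_self hA]
      rcases eq_of_sum_eq_three (B := Finset.Icc 1 (m + 1) \ insert (m + 1) B)
        (fun b hb => (Finset.mem_Icc.1 (Finset.sdiff_subset hb)).1) (by omega) with h | h
      · left; rwa [h] at h2
      · right; rwa [h] at h2
    · left
      have h1 := weight_le_max hB
      have h2 := sum_insert_succ hB
      rw [weight_insert (lt_succ_of_subset_Icc hB)]
      have h3 : e - (m + 1) = ∑ a ∈ B, a := by omega
      have h4 : (e : ℤ) = ((∑ a ∈ B, a : ℕ) : ℤ) + (m + 1) := by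
        exact_mod_cast hsum.symm.trans h2
      have h5 := domqc_lt_qc he (show k + 1 ≤ m + 1 by omega) (by omega)
      have h6 := qs_lt_qc he hhalf hn (show k + 1 ≤ m + 1 by omega) hm
      rw [qs_succ (by omega), h3] at h6
      rw [domqc, h3] at h5
      push_cast at h4 h5 h6 ⊢
      rcases le_max_iff.1 h1 with h | h <;> linarith

theorem Icc_sdiff_Icc_sdiff_three {n k : ℕ} (hk : 3 ≤ k) (hkn : k ≤ n) :
    Finset.Icc 1 n \ (Finset.Icc 1 k \ {3}) = Finset.Icc (k + 1) n ∪ {3} := by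
  ext a
  simp only [Finset.mem_sdiff, Finset.mem_union, Finset.mem_Icc, Finset.mem_singleton]
  omega

theorem Icc_sdiff_Icc_sdiff_one_two {n k : ℕ} (hk : 3 ≤ k) (hkn : k ≤ n) :
    Finset.Icc 1 n \ (Finset.Icc 1 k \ {1, 2}) = Finset.Icc (k + 1) n ∪ {1, 2} := by
  ext a
  simp only [Finset.mem_sdiff, Finset.mem_union, Finset.mem_Icc, Finset.mem_insert,
    Finset.mem_singleton]
  omega

/-- The four sets of parts are partitions of `e`. -/
theorem sum_eq_of_balanced {n k e : ℕ} (he : e + 3 = tri k) (hk : 3 ≤ k) (hhalf : 2 * e = tri n)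
    (hkn : k ≤ n) {A : Finset ℕ}
    (hA : A = Finset.Icc (k + 1) n ∪ {3} ∨ A = Finset.Icc (k + 1) n ∪ {1, 2} ∨
      A = Finset.Icc 1 k \ {3} ∨ A = Finset.Icc 1 k \ {1, 2}) : ∑ a ∈ A, a = e := by
  have key : ∀ {B}, B = Finset.Icc 1 k \ {3} ∨ B = Finset.Icc 1 k \ {1, 2} →
      ∑ a ∈ Finset.Icc 1 n \ B, a = e := fun {B} hB => by
    obtain ⟨h1, h2, -⟩ := weight_eq_qc_of_sdiff hk he hB
    have := sum_sdiff_Icc (h1.trans (Finset.Icc_subset_Icc_right hkn))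
    omega
  rcases hA with rfl | rfl | h | h
  · rw [← Icc_sdiff_Icc_sdiff_three hk hkn]; exact key (Or.inl rfl)
  · rw [← Icc_sdiff_Icc_sdiff_one_two hk hkn]; exact key (Or.inr rfl)
  · exact (weight_eq_qc_of_sdiff hk he (Or.inl h)).2.1
  · exact (weight_eq_qc_of_sdiff hk he (Or.inr h)).2.1

/-- The maximum of the weight in the balanced situation, and the four sets of parts attaining it. -/
theorem weight_balanced {n k e : ℕ} (he : e + 3 = tri k) (hk : 4 ≤ k) (hhalf : 2 * e = tri n)
    (hn : n + 5 ≤ 2 * k) (hkn : k < n) {A : Finset ℕ} (hA : A ⊆ Finset.Icc 1 n)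
    (hsum : ∑ a ∈ A, a = e) :
    weight A ≤ qc e ∧ (weight A = qc e ↔
      A = Finset.Icc (k + 1) n ∪ {3} ∨ A = Finset.Icc (k + 1) n ∪ {1, 2} ∨
      A = Finset.Icc 1 k \ {3} ∨ A = Finset.Icc 1 k \ {1, 2}) := by
  have hcw : weight (Finset.Icc 1 n \ A) = weight A := by
    have h4 : 2 * (e : ℤ) = tri n := by exact_mod_cast hhalf
    rw [compl_weight hA, hsum]
    linear_combination -(2 * n : ℤ) * h4 - (n : ℤ) * two_mul_tri_cast n
  have hcs : ∑ a ∈ Finset.Icc 1 n \ A, a = e := by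
    have := sum_sdiff_Icc hA
    omega
  have hc3 := Icc_sdiff_Icc_sdiff_three (show 3 ≤ k by omega) hkn.le
  have hc12 := Icc_sdiff_Icc_sdiff_one_two (show 3 ≤ k by omega) hkn.le
  have hkey : weight A < qc e ∨ A = Finset.Icc (k + 1) n ∪ {3} ∨
      A = Finset.Icc (k + 1) n ∪ {1, 2} ∨
      A = Finset.Icc 1 k \ {3} ∨ A = Finset.Icc 1 k \ {1, 2} := by
    obtain ⟨m, rfl⟩ : ∃ m, n = m + 1 := ⟨n - 1, by omega⟩
    by_cases hmem : m + 1 ∈ A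
    · have hsub : Finset.Icc 1 (m + 1) \ A ⊆ Finset.Icc 1 m := fun a ha => by
        have h1 := Finset.mem_sdiff.1 ha
        have h2 := Finset.mem_Icc.1 h1.1
        have h3 : a ≠ m + 1 := fun h => h1.2 (h ▸ hmem)
        exact Finset.mem_Icc.2 ⟨h2.1, by omega⟩
      have hdd := Finset.sdiff_sdiff_eq_self hA
      rcases weight_of_subset he hk hhalf hn (Nat.lt_succ_self m) hsub hcs with h | h | h
      · left; rwa [hcw] at h
      · rw [h, hc3] at hdd; exact Or.inr (Or.inl hdd.symm)
      · rw [h, hc12] at hdd; exact Or.inr (Or.inr (Or.inl hdd.symm))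
    · rcases subset_Icc_succ hA with ⟨-, hA'⟩ | ⟨B, hB, rfl⟩
      · rcases weight_of_subset he hk hhalf hn (Nat.lt_succ_self m) hA' hsum with h | h | h
        · exact Or.inl h
        · exact Or.inr (Or.inr (Or.inr (Or.inl h)))
        · exact Or.inr (Or.inr (Or.inr (Or.inr h)))
      · exact absurd (Finset.mem_insert_self _ _) hmem
  have hback : (A = Finset.Icc (k + 1) n ∪ {3} ∨ A = Finset.Icc (k + 1) n ∪ {1, 2} ∨
      A = Finset.Icc 1 k \ {3} ∨ A = Finset.Icc 1 k \ {1, 2}) → weight A = qc e := by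
    have hsub : ∀ B : Finset ℕ, Finset.Icc 1 k \ B ⊆ Finset.Icc 1 n := fun B =>
      Finset.sdiff_subset.trans (Finset.Icc_subset_Icc_right hkn.le)
    rintro (h | h | h | h)
    · rw [← hc3] at h
      rw [← hcw, h, Finset.sdiff_sdiff_eq_self (hsub _)]
      exact (weight_eq_qc_of_sdiff (by omega) he (Or.inl rfl)).2.2
    · rw [← hc12] at h
      rw [← hcw, h, Finset.sdiff_sdiff_eq_self (hsub _)]
      exact (weight_eq_qc_of_sdiff (by omega) he (Or.inr rfl)).2.2
    · exact (weight_eq_qc_of_sdiff (by omega) he (Or.inl h)).2.2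
    · exact (weight_eq_qc_of_sdiff (by omega) he (Or.inr h)).2.2
  refine ⟨?_, fun h => ?_, hback⟩
  · rcases hkey with h | h
    · exact h.le
    · exact (hback h).le
  · rcases hkey with h' | h'
    · exact absurd h h'.ne
    · exact h'

/-! ### Threshold graphs maximise the sum of squares -/

open Classical in
theorem sum_adj_eq_degree {V : Type*} [Fintype V] (G : SimpleGraph V) (x : V) :
    ∑ y, (if G.Adj x y then (1 : ℤ) else 0) = G.degree x := by
  rw [Finset.sum_boole, ← SimpleGraph.card_neighborFinset_eq_degree,
    SimpleGraph.neighborFinset_eq_filter]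

open Classical in
/-- Moving an edge from `yz` to `xz` does not change the number of edges, and increases the sum of
the squares of the degrees if `x` had at least the degree of `y`. -/
theorem exists_lt_sum_sq {V : Type*} [Fintype V] (G : SimpleGraph V) {x y z : V}
    (hd : G.degree y ≤ G.degree x) (hyz : G.Adj y z) (hxz : ¬ G.Adj x z) (hne : x ≠ z) :
    ∃ H : SimpleGraph V, ∑ i, H.degree i = ∑ i, G.degree i ∧
      ∑ i, G.degree i ^ 2 < ∑ i, H.degree i ^ 2 := by
  have hxy : x ≠ y := fun h => hxz (h ▸ hyz)
  have hyz' : y ≠ z := hyz.ne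
  have hzy := hyz.symm
  have hzx : ¬ G.Adj z x := fun h => hxz h.symm
  obtain ⟨H, hH⟩ : ∃ H : SimpleGraph V, ∀ i j, H.Adj i j ↔
      (G.Adj i j ∧ ¬ (i = y ∧ j = z) ∧ ¬ (i = z ∧ j = y)) ∨
        (i = x ∧ j = z) ∨ (i = z ∧ j = x) :=
    ⟨{  Adj := fun i j => (G.Adj i j ∧ ¬ (i = y ∧ j = z) ∧ ¬ (i = z ∧ j = y)) ∨
          (i = x ∧ j = z) ∨ (i = z ∧ j = x)
        symm := ⟨fun i j h => by
          rcases h with ⟨h, h1, h2⟩ | h | h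
          · exact Or.inl ⟨h.symm, fun h' => h2 h'.symm, fun h' => h1 h'.symm⟩
          · exact Or.inr (Or.inr h.symm)
          · exact Or.inr (Or.inl h.symm)⟩
        loopless := ⟨fun i h => by
          rcases h with ⟨h, -⟩ | h | h
          · exact G.loopless.irrefl i h
          · exact hne (h.1.symm.trans h.2)
          · exact hne (h.2.symm.trans h.1)⟩ }, fun _ _ => Iff.rfl⟩
  have hdeg : ∀ i, (H.degree i : ℤ) =
      G.degree i + ((if i = x then 1 else 0) - (if i = y then 1 else 0)) := by
    intro i
    have hadj : ∀ j, (if H.Adj i j then (1 : ℤ) else 0) = (if G.Adj i j then 1 else 0) +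
        ((if j = z then (if i = x then 1 else 0) else 0) +
        (if j = x then (if i = z then 1 else 0) else 0) -
        (if j = z then (if i = y then 1 else 0) else 0) -
        (if j = y then (if i = z then 1 else 0) else 0)) := by
      intro j
      have := hH i j
      grind
    rw [← sum_adj_eq_degree, Finset.sum_congr rfl fun j _ => hadj j]
    simp only [Finset.sum_add_distrib, Finset.sum_sub_distrib, Finset.sum_ite_eq',
      Finset.mem_univ, if_true, sum_adj_eq_degree]
    ring
  refine ⟨H, ?_, ?_⟩
  · have h : ∑ i, (H.degree i : ℤ) = ∑ i, (G.degree i : ℤ) := by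
      simp [hdeg, Finset.sum_add_distrib, Finset.sum_sub_distrib]
    exact_mod_cast h
  · have h : ∑ i, (H.degree i : ℤ) ^ 2 = ∑ i, (G.degree i : ℤ) ^ 2 +
        (2 * G.degree x - 2 * G.degree y + 2) := by
      have h1 : ∀ i, (H.degree i : ℤ) ^ 2 = (G.degree i : ℤ) ^ 2 +
          ((if i = x then 2 * (G.degree i : ℤ) + 1 else 0) -
            (if i = y then 2 * (G.degree i : ℤ) - 1 else 0)) := by
        intro i
        rw [hdeg]
        by_cases hx : i = x
        · have : i ≠ y := fun h => hxy (hx.symm.trans h)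
          simp only [hx, if_true, if_neg hxy]; ring
        · by_cases hy : i = y
          · simp only [hy, if_true, if_neg hxy.symm]; ring
          · simp only [if_neg hx, if_neg hy]; ring
      rw [Finset.sum_congr rfl fun i _ => h1 i]
      simp only [Finset.sum_add_distrib, Finset.sum_sub_distrib, Finset.sum_ite_eq',
        Finset.mem_univ, if_true]
      ring
    have hd' : (G.degree y : ℤ) ≤ G.degree x := by exact_mod_cast hd
    have : ∑ i, (G.degree i : ℤ) ^ 2 < ∑ i, (H.degree i : ℤ) ^ 2 := by linarith
    exact_mod_cast this

open Classical in
/-- A graph with given degree sum and the largest sum of squares of degrees has an isolated or a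
dominating vertex: a vertex of maximum degree is joined to all vertices that are not isolated. -/
theorem exists_isolated_or_dominating {V : Type*} [Fintype V] [Nonempty V] (G : SimpleGraph V)
    (hG : ∀ H : SimpleGraph V, ∑ i, H.degree i = ∑ i, G.degree i →
      ∑ i, H.degree i ^ 2 ≤ ∑ i, G.degree i ^ 2) :
    ∃ x, (∀ y, ¬ G.Adj x y) ∨ ∀ y, y ≠ x → G.Adj x y := by
  obtain ⟨x, -, hx⟩ := Finset.exists_max_image Finset.univ (fun i => G.degree i)
    Finset.univ_nonempty
  have hx' : ∀ i, G.degree i ≤ G.degree x := fun i => hx i (Finset.mem_univ i)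
  have hswap : ∀ y z, G.Adj y z → x ≠ z → G.Adj x z := fun y z hyz hne => by
    by_contra h
    obtain ⟨H, h1, h2⟩ := exists_lt_sum_sq G (hx' y) hyz h hne
    exact absurd (hG H h1) (not_le.2 h2)
  by_cases h : ∃ y, ∀ z, ¬ G.Adj y z
  · obtain ⟨y, hy⟩ := h
    exact ⟨y, Or.inl hy⟩
  · push Not at h
    refine ⟨x, Or.inr fun y hy => ?_⟩
    obtain ⟨z, hz⟩ := h y
    exact hswap z y hz.symm hy.symm

open Classical in
theorem degree_eq_add_degree {V : Type*} [Fintype V] {G : SimpleGraph V} {x : V}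
    {H : SimpleGraph {i // i ≠ x}} (hH : ∀ i j, H.Adj i j ↔ G.Adj i j) (i : {i // i ≠ x}) :
    (G.degree i : ℤ) = (if G.Adj i x then 1 else 0) + H.degree i := by
  rw [← sum_adj_eq_degree, ← sum_adj_eq_degree, Fintype.sum_eq_add_sum_subtype_ne _ x]
  simp only [hH]

open Classical in
/-- Every graph on `n + 1` vertices is dominated by the threshold graph of a set of parts. -/
theorem exists_weight_ge {n : ℕ} : ∀ {V : Type} [Fintype V] (G : SimpleGraph V),
    Fintype.card V = n + 1 → ∃ A ⊆ Finset.Icc 1 n,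
      ∑ i, G.degree i = 2 * ∑ a ∈ A, a ∧ ((∑ i, G.degree i ^ 2 : ℕ) : ℤ) ≤ weight A := by
  induction n with
  | zero =>
    intro V _ G hV
    have h : ∀ i, G.degree i = 0 := fun i => by
      have := G.degree_lt_card_verts i
      omega
    exact ⟨∅, by simp, by simp [h], by simp [h, weight_empty]⟩
  | succ n ih =>
    intro V _ G₀ hV
    have : Nonempty V := Fintype.card_pos_iff.1 (by omega)
    obtain ⟨G, hG, hmax⟩ := Finset.exists_max_image
      (Finset.univ.filter fun H : SimpleGraph V => ∑ i, H.degree i = ∑ i, G₀.degree i)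
      (fun H => ∑ i, H.degree i ^ 2) ⟨G₀, by simp⟩
    simp only [Finset.mem_filter, Finset.mem_univ, true_and] at hG hmax
    have hG₀ : ((∑ i, G₀.degree i ^ 2 : ℕ) : ℤ) ≤ (∑ i, G.degree i ^ 2 : ℕ) :=
      Nat.cast_le.2 (hmax G₀ rfl)
    obtain ⟨x, hx⟩ := exists_isolated_or_dominating G fun H hH => hmax H (hH.trans hG)
    have hcard : Fintype.card {i // i ≠ x} = n + 1 := by
      rw [Fintype.card_subtype_compl, Fintype.card_subtype_eq]; omega
    obtain ⟨H, hH⟩ : ∃ H : SimpleGraph {i // i ≠ x}, ∀ i j, H.Adj i j ↔ G.Adj i j :=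
      ⟨G.comap Subtype.val, fun _ _ => Iff.rfl⟩
    obtain ⟨A, hA, hsum, hsq⟩ := ih H hcard
    have hdeg := degree_eq_add_degree hH
    have hs : (∑ i, (G.degree i : ℤ)) = G.degree x + ∑ i : {i // i ≠ x}, (G.degree i : ℤ) :=
      Fintype.sum_eq_add_sum_subtype_ne _ x
    have hq : (∑ i, (G.degree i : ℤ) ^ 2) =
        (G.degree x : ℤ) ^ 2 + ∑ i : {i // i ≠ x}, (G.degree i : ℤ) ^ 2 :=
      Fintype.sum_eq_add_sum_subtype_ne (fun i => (G.degree i : ℤ) ^ 2) x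
    have hsum' : (∑ i, (H.degree i : ℤ)) =
        2 * ((∑ a ∈ A, a : ℕ) : ℤ) := by exact_mod_cast hsum
    push_cast at hsq
    rw [← hG]
    rcases hx with hx | hx
    · have hx0 : (G.degree x : ℤ) = 0 := by
        rw [← sum_adj_eq_degree]
        exact Finset.sum_eq_zero fun y _ => if_neg (hx y)
      have hdeg' : ∀ i : {i // i ≠ x}, (G.degree i : ℤ) =
          H.degree i := fun i => by
        rw [hdeg, if_neg fun h => hx _ h.symm, zero_add]
      refine ⟨A, hA.trans (Finset.Icc_subset_Icc_right (by omega)), ?_, ?_⟩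
      · simp only [hdeg'] at hs
        rw [hx0, zero_add, hsum'] at hs
        exact_mod_cast hs
      · simp only [hdeg'] at hq
        refine hG₀.trans ?_
        push_cast
        rw [hq, hx0]
        linarith
    · have hdeg' : ∀ i : {i // i ≠ x}, (G.degree i : ℤ) =
          1 + H.degree i := fun i => by
        rw [hdeg, if_pos (hx _ i.2).symm]
      have hx0 : (G.degree x : ℤ) = n + 1 := by
        rw [← sum_adj_eq_degree, Fintype.sum_eq_add_sum_subtype_ne _ x,
          if_neg (G.loopless.irrefl x), Finset.sum_congr rfl fun i _ => if_pos (hx _ i.2)]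
        simp only [Finset.sum_const, Finset.card_univ, hcard]
        simp
      refine ⟨insert (n + 1) A, ?_, ?_, ?_⟩
      · intro a ha
        rcases Finset.mem_insert.1 ha with rfl | ha
        · simp
        · have := Finset.mem_Icc.1 (hA ha)
          exact Finset.mem_Icc.2 ⟨this.1, by omega⟩
      · rw [sum_insert_succ hA]
        simp only [hdeg', Finset.sum_add_distrib, hsum', hx0] at hs
        simp only [Finset.sum_const, Finset.card_univ, hcard] at hs
        have : (∑ i, (G.degree i : ℤ)) = ((2 * (∑ a ∈ A, a + (n + 1)) : ℕ) : ℤ) := by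
          rw [hs]; push_cast; simp; ring
        exact_mod_cast this
      · refine hG₀.trans ?_
        rw [weight_insert (lt_succ_of_subset_Icc hA)]
        simp only [hdeg', add_sq, Finset.sum_add_distrib, mul_one, one_pow, ← Finset.mul_sum,
          hsum', hx0] at hq
        simp only [Finset.sum_const, Finset.card_univ, hcard] at hq
        push_cast at hq ⊢
        rw [hq]
        simp
        linarith

/-! ### The degrees of the threshold graph of a partition -/

/-- Row `s` of a threshold graph has its last entry before column `a` if all parts are below `a`. -/
theorem add_getD_lt {π : List ℕ} : ∀ {a : ℕ}, π.Pairwise (· > ·) → (∀ b ∈ π, 0 < b ∧ b < a) →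
    ∀ s, π.getD s 0 = 0 ∨ s + π.getD s 0 < a := by
  induction π with
  | nil => intro a _ _ s; simp
  | cons c π ih =>
    intro a hp hb s
    rw [List.pairwise_cons] at hp
    have hc := hb c List.mem_cons_self
    cases s with
    | zero => right; simpa using hc.2
    | succ s =>
      rcases ih hp.2 (a := c) (fun b hb' => ⟨(hb b (List.mem_cons_of_mem _ hb')).1, hp.1 b hb'⟩) s
        with h | h
      · left; simpa using h
      · right; simp only [List.getD_cons_succ]; omega

theorem adj_Th_lt {v a : ℕ} {π : List ℕ} (hp : π.Pairwise (· > ·))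
    (hb : ∀ b ∈ π, 0 < b ∧ b < a) {s t : Fin v} (h : (Th v π).Adj s t) : (s : ℕ) < a := by
  rcases h with ⟨h1, h2⟩ | ⟨h1, h2⟩
  · have h1 : (s : ℕ) < t := h1
    rcases add_getD_lt hp hb s with h | h <;> omega
  · have h1 : (t : ℕ) < s := h1
    rcases add_getD_lt hp hb t with h | h <;> omega

theorem Th_cons_adj_succ {v a : ℕ} {π : List ℕ} (s t : Fin v) :
    (Th (v + 1) (a :: π)).Adj s.succ t.succ ↔ (Th v π).Adj s t := by
  simp only [Th, Fin.succ_lt_succ_iff, Fin.val_succ, List.getD_cons_succ]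
  refine or_congr (and_congr_right fun _ => ?_) (and_congr_right fun _ => ?_) <;> omega

theorem Th_cons_adj_zero {v a : ℕ} {π : List ℕ} (t : Fin v) :
    (Th (v + 1) (a :: π)).Adj 0 t.succ ↔ (t : ℕ) < a := by
  simp [Th, Fin.val_succ]

theorem sum_lt_indicator {v a : ℕ} (h : a ≤ v) :
    ∑ t : Fin v, (if (t : ℕ) < a then (1 : ℤ) else 0) = a := by
  rw [Fin.sum_univ_eq_sum_range (fun i => if i < a then (1 : ℤ) else 0), Finset.sum_boole]
  have : (Finset.range v).filter (· < a) = Finset.range a := by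
    ext i; simp only [Finset.mem_filter, Finset.mem_range]; omega
  rw [this, Finset.card_range]

open Classical in
theorem sum_degree_Th {π : List ℕ} : ∀ {v : ℕ}, π.Pairwise (· > ·) →
    (∀ b ∈ π, 0 < b ∧ b < v) →
    ∑ i, ((Th v π).degree i : ℤ) = 2 * (π.sum : ℤ) ∧
      ∑ i, ((Th v π).degree i : ℤ) ^ 2 = weight π.toFinset ∧
      ∑ b ∈ π.toFinset, b = π.sum := by
  induction π with
  | nil =>
    intro v _ _
    have h : ∀ i, ((Th v []).degree i : ℤ) = 0 := fun i => by
      rw [← sum_adj_eq_degree]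
      exact Finset.sum_eq_zero fun t _ => if_neg fun h => by
        have := adj_Th_lt (a := 0) List.Pairwise.nil (by simp) h
        omega
    simp [h, weight_empty]
  | cons a π ih =>
    intro v hp hb
    have ha := hb a List.mem_cons_self
    obtain ⟨v, rfl⟩ : ∃ w, v = w + 1 := ⟨v - 1, by omega⟩
    rw [List.pairwise_cons] at hp
    have hb' : ∀ b ∈ π, 0 < b ∧ b < a := fun b h =>
      ⟨(hb b (List.mem_cons_of_mem _ h)).1, hp.1 b h⟩
    obtain ⟨h1, h2, h3⟩ := ih (v := v) hp.2 fun b h => ⟨(hb' b h).1, by have := (hb' b h).2; omega⟩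
    have hd0 : ((Th (v + 1) (a :: π)).degree 0 : ℤ) = a := by
      rw [← sum_adj_eq_degree, Fin.sum_univ_succ,
        if_neg ((Th (v + 1) (a :: π)).loopless.irrefl 0), zero_add]
      simp only [Th_cons_adj_zero]
      exact sum_lt_indicator (by omega)
    have hd : ∀ s : Fin v, ((Th (v + 1) (a :: π)).degree s.succ : ℤ) =
        (if (s : ℕ) < a then 1 else 0) + (Th v π).degree s := fun s => by
      rw [← sum_adj_eq_degree, Fin.sum_univ_succ, ← sum_adj_eq_degree]
      simp only [Th_cons_adj_succ, SimpleGraph.adj_comm _ s.succ 0, Th_cons_adj_zero]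
    -- A vertex of positive degree in the threshold graph of the tail is joined to vertex `0`.
    have hsq : ∀ s : Fin v, ((if (s : ℕ) < a then (1 : ℤ) else 0) + (Th v π).degree s) ^ 2 =
        (if (s : ℕ) < a then 1 else 0) + 2 * ((Th v π).degree s : ℤ) +
          ((Th v π).degree s : ℤ) ^ 2 := fun s => by
      by_cases h : (s : ℕ) < a
      · simp only [h, if_true]; ring
      · have h0 : ((Th v π).degree s : ℤ) = 0 := by
          rw [← sum_adj_eq_degree]
          exact Finset.sum_eq_zero fun t _ => if_neg fun hst => h (adj_Th_lt hp.2 hb' hst)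
        simp [h, h0]
    have hlt : ∀ b ∈ π.toFinset, b < a := fun b h => (hb' b (List.mem_toFinset.1 h)).2
    have hna : a ∉ π.toFinset := fun h => lt_irrefl _ (hlt a h)
    refine ⟨?_, ?_, ?_⟩
    · rw [Fin.sum_univ_succ, hd0]
      simp only [hd, Finset.sum_add_distrib]
      rw [sum_lt_indicator (by omega), h1, List.sum_cons]
      push_cast
      ring
    · rw [Fin.sum_univ_succ, hd0]
      simp only [hd, hsq, Finset.sum_add_distrib, ← Finset.mul_sum]
      rw [sum_lt_indicator (by omega), h1, h2, List.toFinset_cons, weight_insert hlt, h3]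
      ring
    · rw [List.toFinset_cons, Finset.sum_insert hna, h3, List.sum_cons]

/-! ### Optimal partitions -/

theorem mem_graphClass_iff {v e : ℕ} (G : SimpleGraph (Fin v)) [DecidableRel G.Adj] :
    G ∈ graphClass v e ↔ ∑ i, G.degree i = 2 * e := by
  rw [SimpleGraph.sum_degrees_eq_twice_card_edges, graphClass, Set.mem_ofPred_eq,
    ← SimpleGraph.coe_edgeFinset, Set.ncard_coe_finset]
  omega

theorem eq_of_pairwise_gt_of_mem_iff {l l' : List ℕ} (h : l.Pairwise (· > ·))
    (h' : l'.Pairwise (· > ·)) (hmem : ∀ a, a ∈ l ↔ a ∈ l') : l = l' := by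
  have h1 : l.Nodup := h.imp fun hab => ne_of_gt hab
  have h2 : l'.Nodup := h'.imp fun hab => ne_of_gt hab
  exact ((List.perm_ext_iff_of_nodup h1 h2).2 hmem).eq_of_pairwise
    (fun _ _ _ _ hab hba => absurd (lt_trans hab hba) (lt_irrefl _)) h h'

theorem mem_desc {a x y : ℕ} : a ∈ desc x y ↔ y ≤ a ∧ a ≤ x := by
  rw [desc, List.mem_reverse, List.mem_range'_1]
  omega

theorem pairwise_desc (x y : ℕ) : (desc x y).Pairwise (· > ·) := by
  rw [desc, List.pairwise_reverse]
  exact List.pairwise_lt_range'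

theorem pairwise_desc_append {x y : ℕ} {l : List ℕ} (hl : l.Pairwise (· > ·))
    (h : ∀ b ∈ l, b < y) : (desc x y ++ l).Pairwise (· > ·) :=
  List.pairwise_append.2 ⟨pairwise_desc x y, hl, fun _ ha b hb =>
    lt_of_lt_of_le (h b hb) (mem_desc.1 ha).1⟩

/-- In the balanced situation a partition is optimal exactly if its set of parts has the
quasi-complete weight. -/
theorem isOptimalPartition_iff {n k e : ℕ} (he : e + 3 = tri k) (hk : 4 ≤ k)
    (hhalf : 2 * e = tri n) (hn : n + 5 ≤ 2 * k) (hkn : k < n) {π₀ : List ℕ}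
    (hπ₀ : π₀ ∈ Dis (n + 1) e) (hw₀ : weight π₀.toFinset = qc e) (π : List ℕ) :
    IsOptimalPartition (n + 1) e π ↔ π ∈ Dis (n + 1) e ∧ weight π.toFinset = qc e := by
  classical
  have hP2 : ∀ {π}, π ∈ Dis (n + 1) e → (P2 (Th (n + 1) π) : ℤ) = weight π.toFinset ∧
      Th (n + 1) π ∈ graphClass (n + 1) e := by
    rintro π ⟨h1, h2, h3⟩
    obtain ⟨h4, h5, -⟩ := sum_degree_Th h1 h2
    refine ⟨?_, (mem_graphClass_iff _).2 ?_⟩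
    · rw [← h5, P2]
      push_cast
      rfl
    · rw [h3] at h4
      exact_mod_cast h4
  have hle : ∀ H ∈ graphClass (n + 1) e, (P2 H : ℤ) ≤ qc e := by
    intro H hH
    obtain ⟨A, hA, h1, h2⟩ := exists_weight_ge H (Fintype.card_fin (n + 1))
    have h3 := (mem_graphClass_iff H).1 hH
    have h5 := (weight_balanced he hk hhalf hn hkn hA (by omega)).1
    exact le_trans h2 h5
  constructor
  · rintro ⟨h1, h2, h3⟩
    refine ⟨h1, le_antisymm ?_ ?_⟩
    · rw [← (hP2 h1).1]
      exact hle _ h2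
    · rw [← (hP2 h1).1, ← hw₀, ← (hP2 hπ₀).1]
      exact_mod_cast h3 _ (hP2 hπ₀).2
  · rintro ⟨h1, h2⟩
    refine ⟨h1, (hP2 h1).2, fun H hH => ?_⟩
    have h3 := hle H hH
    rw [← h2, ← (hP2 h1).1] at h3
    exact_mod_cast h3

/-! ### The Pell equation -/

theorem tri_params_unique {e k j k' j' : ℕ} (h : e + j = tri k) (hj : 1 ≤ j) (hjk : j ≤ k)
    (h' : e + j' = tri k') (hj' : 1 ≤ j') (hjk' : j' ≤ k') : k = k' ∧ j = j' := by
  have aux : ∀ {a b x y : ℕ}, e + x = tri a → 1 ≤ x → e + y = tri b → y ≤ b → b ≤ a := by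
    intro a b x y hx hx1 hy hyb
    by_contra hlt
    obtain ⟨c, rfl⟩ : ∃ c, b = c + 1 := ⟨b - 1, by omega⟩
    have := tri_mono (show a ≤ c by omega)
    rw [tri_succ] at hy
    omega
  have hkk : k = k' := le_antisymm (aux h' hj' h hjk) (aux h hj h' hjk')
  subst hkk
  exact ⟨rfl, by omega⟩

theorem isQCParams_iff {e k k₁ j₁ : ℕ} (he : e + 3 = tri k) (hk : 4 ≤ k) :
    IsQCParams e k₁ j₁ ↔ k₁ = k ∧ j₁ = 3 := by
  constructor
  · rintro ⟨h1, h2, h3⟩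
    have h4 : e + j₁ = tri k₁ := by
      rw [tri]
      have : (e : ℤ) + j₁ = ((k₁ + 1).choose 2 : ℤ) := by linarith
      exact_mod_cast this
    exact tri_params_unique h4 h1 h2 he (by omega) (by omega)
  · rintro ⟨rfl, rfl⟩
    refine ⟨by omega, by omega, ?_⟩
    have : (e : ℤ) + 3 = ((k₁ + 1).choose 2 : ℤ) := by rw [tri] at he; exact_mod_cast he
    push_cast
    linarith

theorem isQSParams_iff_isQCParams {v e k j : ℕ} (h : v.choose 2 = 2 * e) :
    IsQSParams v e k j ↔ IsQCParams e k j := by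
  have h' : (v.choose 2 : ℤ) = 2 * e := by exact_mod_cast h
  rw [IsQSParams, IsQCParams, h']
  refine and_congr_right fun _ => and_congr_right fun _ => ?_
  constructor <;> intro h <;> linarith

/-- For `v > 9` a solution of the Pell equation has `C(v,2) = 2 (C(k+1,2) - 3)`, and `v ≤ 2k - 4`,
which rules out `π₁.₂` and `π₂.₂`. -/
theorem PellEq.exists_balanced {v k : ℕ} (hv : 9 < v) (h : PellEq v k) :
    ∃ n e, v = n + 1 ∧ e + 3 = tri k ∧ 2 * e = tri n ∧ 7 ≤ k ∧ n + 5 ≤ 2 * k ∧ k < n := by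
  obtain ⟨n, rfl⟩ : ∃ n, v = n + 1 := ⟨v - 1, by omega⟩
  have h1 : (n : ℤ) * (n + 1) + 12 = 2 * (k * (k + 1)) := by
    rw [PellEq] at h
    push_cast at h
    linarith
  have h2 : n * (n + 1) + 12 = 2 * (k * (k + 1)) := by exact_mod_cast h1
  have hk7 : 7 ≤ k := by
    by_contra hlt
    have : k * (k + 1) ≤ 6 * 7 := Nat.mul_le_mul (by omega) (by omega)
    have : 9 * 10 ≤ n * (n + 1) := Nat.mul_le_mul (by omega) (by omega)
    omega
  have h3 := two_mul_tri n
  have h4 := two_mul_tri k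
  have h5 := le_tri k
  refine ⟨n, tri k - 3, rfl, by omega, by omega, hk7, ?_, ?_⟩
  · by_contra hlt
    obtain ⟨m, rfl⟩ : ∃ m, k = m + 7 := ⟨k - 7, by omega⟩
    have : (2 * m + 10) * (2 * m + 11) ≤ n * (n + 1) := Nat.mul_le_mul (by omega) (by omega)
    nlinarith
  · by_contra hlt
    have : n * (n + 1) ≤ k * (k + 1) := Nat.mul_le_mul (by omega) (by omega)
    have : 7 * 8 ≤ k * (k + 1) := Nat.mul_le_mul (by omega) (by omega)
    omega

/-- The map `(x, y) ↦ (3x + 4y, 2x + 3y)` preserves `x² - 2y²`, which gives solutions with `v`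
arbitrarily large. -/
theorem infinite_pellEq : {v : ℕ | 9 < v ∧ ∃ k : ℕ, 0 < k ∧ PellEq v k}.Infinite := by
  refine Set.infinite_of_forall_exists_gt fun N => ?_
  induction N with
  | zero => exact ⟨12, ⟨by omega, 8, by omega, by norm_num [PellEq]⟩, by omega⟩
  | succ N ih =>
    obtain ⟨v, ⟨hv, k, hk, h⟩, hN⟩ := ih
    refine ⟨3 * v + 4 * k + 1, ⟨by omega, 2 * v + 3 * k, by omega, ?_⟩, by omega⟩
    rw [PellEq] at h ⊢
    push_cast
    linarith

/-! ### The four optimal partitions -/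

theorem theorem2p4 :
    (∀ v k : ℕ, 9 < v → 0 < k → PellEq v k →
      ∃ e : ℕ, (e : ℚ) = (1 / 2 : ℚ) * (v.choose 2 : ℚ) ∧
        (∀ k₁ j₁ : ℕ, IsQCParams e k₁ j₁ ↔ k₁ = k ∧ j₁ = 3) ∧
        (∀ k₁ j₁ : ℕ, IsQSParams v e k₁ j₁ ↔ k₁ = k ∧ j₁ = 3) ∧
        (∀ π, IsPi11 v e π ↔ π = desc (v - 1) (k + 1) ++ [3]) ∧
        (∀ π, IsPi13 v e π ↔ π = desc (v - 1) (k + 1) ++ [2, 1]) ∧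
        (∀ π, IsPi21 e π ↔ π = desc k 4 ++ [2, 1]) ∧
        (∀ π, IsPi23 v e π ↔ π = desc k 4 ++ [3]) ∧
        {π | IsOptimalPartition v e π} =
          {desc (v - 1) (k + 1) ++ [3], desc (v - 1) (k + 1) ++ [2, 1],
            desc k 4 ++ [2, 1], desc k 4 ++ [3]} ∧
        {π | IsOptimalPartition v e π}.ncard = 4 ∧
        (¬ ∃ π, IsPi12 v e π) ∧ (¬ ∃ π, IsPi22 v e π)) ∧
    {v : ℕ | 9 < v ∧ ∃ k : ℕ, 0 < k ∧ PellEq v k}.Infinite := by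
  refine ⟨fun v k hv _ hpell => ?_, infinite_pellEq⟩
  obtain ⟨n, e, rfl, he, hhalf, hk7, hn, hkn⟩ := hpell.exists_balanced hv
  have hchoose : (n + 1).choose 2 = 2 * e := hhalf.symm
  have hqc : ∀ k₁ j₁ : ℕ, IsQCParams e k₁ j₁ ↔ k₁ = k ∧ j₁ = 3 := fun k₁ j₁ =>
    isQCParams_iff he (by omega)
  have hqs : ∀ k₁ j₁ : ℕ, IsQSParams (n + 1) e k₁ j₁ ↔ k₁ = k ∧ j₁ = 3 := fun k₁ j₁ =>
    (isQSParams_iff_isQCParams hchoose).trans (hqc k₁ j₁)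
  have hp11 : (desc n (k + 1) ++ [3]).Pairwise (· > ·) :=
    pairwise_desc_append (by simp) (by simp; omega)
  have hp13 : (desc n (k + 1) ++ [2, 1]).Pairwise (· > ·) :=
    pairwise_desc_append (by simp) (by simp; omega)
  have hp21 : (desc k 4 ++ [2, 1]).Pairwise (· > ·) := pairwise_desc_append (by simp) (by simp)
  have hp23 : (desc k 4 ++ [3]).Pairwise (· > ·) := pairwise_desc_append (by simp) (by simp)
  have h21 : (desc k 1).erase 3 = desc k 4 ++ [2, 1] := by
    refine eq_of_pairwise_gt_of_mem_iff ((pairwise_desc k 1).sublist List.erase_sublist) hp21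
      fun a => ?_
    have hnd : (desc k 1).Nodup := (pairwise_desc k 1).imp fun hab => ne_of_gt hab
    rw [hnd.mem_erase_iff]
    simp only [mem_desc, List.mem_append, List.mem_cons, List.not_mem_nil, or_false]
    omega
  have h23 : desc k 3 = desc k 4 ++ [3] := by
    refine eq_of_pairwise_gt_of_mem_iff (pairwise_desc k 3) hp23 fun a => ?_
    simp only [mem_desc, List.mem_append, List.mem_cons, List.not_mem_nil, or_false]
    omega
  have ht11 : (desc n (k + 1) ++ [3]).toFinset = Finset.Icc (k + 1) n ∪ {3} := by
    ext a; simp [mem_desc]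
  have ht13 : (desc n (k + 1) ++ [2, 1]).toFinset = Finset.Icc (k + 1) n ∪ {1, 2} := by
    ext a; simp [mem_desc]; omega
  have ht21 : (desc k 4 ++ [2, 1]).toFinset = Finset.Icc 1 k \ {3} := by
    ext a; simp [mem_desc]; omega
  have ht23 : (desc k 4 ++ [3]).toFinset = Finset.Icc 1 k \ {1, 2} := by
    ext a; simp [mem_desc]; omega
  have hsub : ∀ {π}, π ∈ Dis (n + 1) e →
      π.toFinset ⊆ Finset.Icc 1 n ∧ ∑ a ∈ π.toFinset, a = e := by
    rintro π ⟨h1, h2, h3⟩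
    refine ⟨fun a ha => ?_, (sum_degree_Th h1 h2).2.2.trans h3⟩
    have := h2 a (List.mem_toFinset.1 ha)
    exact Finset.mem_Icc.2 ⟨this.1, by omega⟩
  have hmem : ∀ {π : List ℕ}, π.Pairwise (· > ·) →
      (π.toFinset = Finset.Icc (k + 1) n ∪ {3} ∨ π.toFinset = Finset.Icc (k + 1) n ∪ {1, 2} ∨
        π.toFinset = Finset.Icc 1 k \ {3} ∨ π.toFinset = Finset.Icc 1 k \ {1, 2}) →
      π ∈ Dis (n + 1) e := by
    intro π hπ hA
    have hb : ∀ a ∈ π, 0 < a ∧ a < n + 1 := fun a ha => by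
      rw [← List.mem_toFinset] at ha
      rcases hA with h | h | h | h <;> rw [h] at ha <;> simp at ha <;> omega
    exact ⟨hπ, hb, (sum_degree_Th hπ hb).2.2.symm.trans
      (sum_eq_of_balanced he (by omega) hhalf hkn.le hA)⟩
  have hopt : ∀ π, IsOptimalPartition (n + 1) e π ↔ π ∈ Dis (n + 1) e ∧
      (π.toFinset = Finset.Icc (k + 1) n ∪ {3} ∨ π.toFinset = Finset.Icc (k + 1) n ∪ {1, 2} ∨
        π.toFinset = Finset.Icc 1 k \ {3} ∨ π.toFinset = Finset.Icc 1 k \ {1, 2}) := fun π => by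
    rw [isOptimalPartition_iff he (by omega) hhalf hn hkn
      (hmem hp21 (Or.inr (Or.inr (Or.inl ht21))))
      (ht21 ▸ (weight_eq_qc_of_sdiff (by omega) he (Or.inl rfl)).2.2)]
    exact and_congr_right fun hπ =>
      (weight_balanced he (by omega) hhalf hn hkn (hsub hπ).1 (hsub hπ).2).2
  have hset : {π | IsOptimalPartition (n + 1) e π} =
      {desc n (k + 1) ++ [3], desc n (k + 1) ++ [2, 1], desc k 4 ++ [2, 1], desc k 4 ++ [3]} := by
    ext π
    have hinj : ∀ {π' : List ℕ}, π.Pairwise (· > ·) → π'.Pairwise (· > ·) →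
        π.toFinset = π'.toFinset → π = π' := fun h h' heq =>
      eq_of_pairwise_gt_of_mem_iff h h' fun a => by
        rw [← List.mem_toFinset, heq, List.mem_toFinset]
    simp only [Set.mem_ofPred_eq, Set.mem_insert_iff, Set.mem_singleton_iff, hopt]
    constructor
    · rintro ⟨⟨hπ, -⟩, h | h | h | h⟩
      · exact Or.inl (hinj hπ hp11 (h.trans ht11.symm))
      · exact Or.inr (Or.inl (hinj hπ hp13 (h.trans ht13.symm)))
      · exact Or.inr (Or.inr (Or.inl (hinj hπ hp21 (h.trans ht21.symm))))
      · exact Or.inr (Or.inr (Or.inr (hinj hπ hp23 (h.trans ht23.symm))))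
    · rintro (rfl | rfl | rfl | rfl)
      · exact ⟨hmem hp11 (Or.inl ht11), Or.inl ht11⟩
      · exact ⟨hmem hp13 (Or.inr (Or.inl ht13)), Or.inr (Or.inl ht13)⟩
      · exact ⟨hmem hp21 (Or.inr (Or.inr (Or.inl ht21))), Or.inr (Or.inr (Or.inl ht21))⟩
      · exact ⟨hmem hp23 (Or.inr (Or.inr (Or.inr ht23))), Or.inr (Or.inr (Or.inr ht23))⟩
  rw [Nat.add_sub_cancel]
  refine ⟨e, ?_, hqc, hqs, fun π => ?_, fun π => ?_, fun π => ?_, fun π => ?_, hset, ?_, ?_, ?_⟩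
  · rw [hchoose]
    push_cast
    ring
  · constructor
    · rintro ⟨k', j', h, rfl⟩
      obtain ⟨rfl, rfl⟩ := (hqs k' j').1 h
      rw [if_neg (by omega)]
      rfl
    · rintro rfl
      exact ⟨k, 3, (hqs k 3).2 ⟨rfl, rfl⟩, by rw [if_neg (by omega)]; rfl⟩
  · constructor
    · rintro ⟨k', j', h, -, rfl⟩
      obtain ⟨rfl, rfl⟩ := (hqs k' j').1 h
      rfl
    · rintro rfl
      exact ⟨k, 3, (hqs k 3).2 ⟨rfl, rfl⟩, ⟨rfl, by omega⟩, rfl⟩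
  · constructor
    · rintro ⟨k', j', h, rfl⟩
      obtain ⟨rfl, rfl⟩ := (hqc k' j').1 h
      exact h21
    · rintro rfl
      exact ⟨k, 3, (hqc k 3).2 ⟨rfl, rfl⟩, h21.symm⟩
  · constructor
    · rintro ⟨k', j', h, -, rfl⟩
      obtain ⟨rfl, rfl⟩ := (hqc k' j').1 h
      exact h23
    · rintro rfl
      exact ⟨k, 3, (hqc k 3).2 ⟨rfl, rfl⟩, ⟨rfl, by omega⟩, h23.symm⟩
  · -- Only the first two partitions contain the part `n`.
    have hn12 : n ∈ desc n (k + 1) := mem_desc.2 ⟨by omega, le_rfl⟩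
    have hne : ∀ l l' : List ℕ, (∀ b ∈ l', b ≤ 3) →
        desc n (k + 1) ++ l ≠ desc k 4 ++ l' := fun l l' hl' h => by
      have h1 : n ∈ desc k 4 ++ l' := h ▸ List.mem_append_left l hn12
      rcases List.mem_append.1 h1 with h1 | h1
      · have := (mem_desc.1 h1).2
        omega
      · have := hl' n h1
        omega
    have h4 : ({desc n (k + 1) ++ [3], desc n (k + 1) ++ [2, 1], desc k 4 ++ [2, 1],
        desc k 4 ++ [3]} : Finset (List ℕ)).card = 4 := by
      rw [Finset.card_insert_of_notMem, Finset.card_insert_of_notMem,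
        Finset.card_insert_of_notMem, Finset.card_singleton]
      · simp
      · simp only [Finset.mem_insert, Finset.mem_singleton, not_or]
        exact ⟨hne _ _ (by simp), hne _ _ (by simp)⟩
      · simp only [Finset.mem_insert, Finset.mem_singleton, not_or]
        exact ⟨by simp, hne _ _ (by simp), hne _ _ (by simp)⟩
    refine Eq.trans ?_ h4
    rw [hset, ← Set.ncard_coe_finset]
    simp only [Finset.coe_insert, Finset.coe_singleton]
  · rintro ⟨π, k', j', h, ⟨-, hle⟩, -⟩
    obtain ⟨rfl, rfl⟩ := (hqs k' j').1 h
    omega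
  · rintro ⟨π, k', j', h, ⟨-, hle⟩, -⟩
    obtain ⟨rfl, rfl⟩ := (hqc k' j').1 h
    omega
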